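/- Let $G$ be a locally compact second countable group and let $A$ be a unital $C^*$-algebra with an action $\alpha$ of $G$, that is, a homomorphism $\alpha : G\to\operatorname{Aut}(A)$ such that $g\mapsto\alpha_g(a)$ is norm continuous for every $a\in A$. Let $S_G(A)$ be the convex set of all $G$-invariant states on $A$. An element of $S_G(A)$ is called ergodic if it is an extreme point of $S_G(A)$, and an element $\psi\in S_G(A)$ is called mixing if $\lim_{g\to\infty}\psi(\alpha_g(a)b)=\psi(a)\psi(b)$ for all $a,b\in A$. Suppose that there are a non-ergodic state $\varphi\in S_G(A)$ and a sequence $(\varphi_n)_{n\ge 1}$ of mixing states in $S_G(A)$ such that $\varphi_n\to\varphi$ in the weak* topology. Then $G$ has the Haagerup property: there is a sequence $(f_n)_{n\ge 1}$ of continuous positive definite functions $f_n:G\to\mathbb{C}$ with $f_n(1)=1$, each vanishing at infinity, that converges to $1$ uniformly on every compact subset of $G$. -/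

import Mathlib

open Filter Topology
open scoped ComplexOrder

/-- A function `f : G → ℂ` on a group is positive definite if
`∑ i, ∑ j, conj (c i) * c j * f ((g i)⁻¹ * g j) ≥ 0` for all finite families of scalars `c i` and
group elements `g i`.  (In the order of `ℂ`, `0 ≤ z` means that `z` is real and nonnegative.) -/
def IsPositiveDefiniteFun {G : Type*} [Group G] (f : G → ℂ) : Prop :=
  ∀ (n : ℕ) (c : Fin n → ℂ) (g : Fin n → G),
    0 ≤ ∑ i, ∑ j, star (c i) * c j * f ((g i)⁻¹ * g j)

/-- The set `P_{0,1}(G)` of continuous, normalized, positive definite functions on `G` that vanish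
at infinity. -/
def normalizedPosDefC0 (G : Type*) [Group G] [TopologicalSpace G] : Set (G → ℂ) :=
  {f | Continuous f ∧ f 1 = 1 ∧ IsPositiveDefiniteFun f ∧ Tendsto f (cocompact G) (𝓝 0)}

/-- The Haagerup property: there is a sequence in `P_{0,1}(G)` converging to the constant function
`1` uniformly on every compact subset of `G`. -/
def HaagerupProperty (G : Type*) [Group G] [TopologicalSpace G] : Prop :=
  ∃ f : ℕ → G → ℂ, (∀ n, f n ∈ normalizedPosDefC0 G) ∧
    ∀ K : Set G, IsCompact K → TendstoUniformlyOn f (fun _ => 1) atTop K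

/-- A continuous action of `G` on a unital C⋆-algebra `A`: a homomorphism from `G` to the group of
⋆-automorphisms of `A` whose orbit maps `g ↦ α_g(a)` are norm continuous. -/
structure CStarAction (G A : Type*) [Group G] [TopologicalSpace G] [CStarAlgebra A] where
  toHom : G →* (A ≃⋆ₐ[ℂ] A)
  continuous_orbit : ∀ a : A, Continuous fun g : G => toHom g a

/-- The state space `S(A)`, a subset of the dual of `A` with its weak-⋆ topology. -/
def stateSpace (A : Type*) [CStarAlgebra A] : Set (WeakDual ℂ A) :=
  {φ | (∀ a : A, 0 ≤ φ (star a * a)) ∧ φ 1 = 1}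

namespace CStarAction

variable {G A : Type*} [Group G] [TopologicalSpace G] [CStarAlgebra A]

/-- The set `S_G(A)` of `G`-invariant states. -/
def invariantStates (α : CStarAction G A) : Set (WeakDual ℂ A) :=
  {φ | φ ∈ stateSpace A ∧ ∀ (g : G) (a : A), φ (α.toHom g a) = φ a}

/-- The set `Erg_G(A)` of ergodic states: the extreme points of `S_G(A)`. -/
def ergodicStates (α : CStarAction G A) : Set (WeakDual ℂ A) :=
  α.invariantStates.extremePoints ℝ

/-- The set `S_{G,m}(A)` of mixing states: the invariant states `φ` such that
`φ(α_g(a) b) → φ(a) φ(b)` as `g → ∞`, for all `a` and `b`. -/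
def mixingStates (α : CStarAction G A) : Set (WeakDual ℂ A) :=
  {φ | φ ∈ α.invariantStates ∧ ∀ a b : A,
    Tendsto (fun g : G => φ (α.toHom g a * b)) (cocompact G) (𝓝 (φ a * φ b))}

end CStarAction

/-!
The proof turns a convex decomposition of the non-ergodic limit `φ` into an almost invariant element
of `A`, and the mixing states near `φ` into `C₀` positive definite functions.

If `φ` is not extreme, then `φ = s φ₁ + t φ₂` with invariant states and `φ₁ ≠ φ`, and `ω = φ₁ - φ` is
a nonzero invariant functional with `ω(1) = 0` that is bounded for the seminorm
`‖a‖_φ = φ(a⋆a)^(1/2)`. In the GNS space of `φ`, it is represented by an invariant vector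
orthogonal to the cyclic vector. The GNS space itself is not needed: if `φ(a) = 0`, `‖a‖_φ = 1` and
`|ω(a)|` is close to the norm of `ω`, then `ω(α_g(a) + a) = 2 ω(a)` shows that `‖α_g(a) + a‖_φ` is
close to `2`, so that `φ(α_g(a⋆) a)` is close to `1` for all `g` at once
(`CStarAction.exists_almost_invariant`).

For a mixing state `ψ`, the function `g ↦ ψ(α_g(a⋆) a) - |ψ(a)|²` is continuous, positive definite
and vanishes at infinity (`CStarAction.covariance_div_mem`). Along a sequence of mixing states
converging weak-⋆ to `φ` it converges to `φ(α_g(a⋆) a)`, uniformly for `g` in a compact set, since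
the elements `α_g(a⋆) a` then form a norm compact set
(`WeakDual.tendstoUniformlyOn_of_isCompact`). A compact exhaustion of `G` supplies the sequence.
-/

section

variable {A : Type*} [CStarAlgebra A]

/-! ### Elementary properties of states -/

namespace stateSpace

variable {φ : WeakDual ℂ A}

theorem im_apply_star_mul_self (hφ : φ ∈ stateSpace A) (a : A) : (φ (star a * a)).im = 0 :=
  (Complex.nonneg_iff.mp (hφ.1 a)).2.symm

theorem re_apply_star_mul_self_nonneg (hφ : φ ∈ stateSpace A) (a : A) :
    0 ≤ (φ (star a * a)).re :=
  (Complex.nonneg_iff.mp (hφ.1 a)).1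

/-- States are hermitian, by polarization: `φ` is real on `x⋆x` for `x = a + 1` and
`x = a + i`. -/
theorem apply_star (hφ : φ ∈ stateSpace A) (a : A) : φ (star a) = star (φ a) := by
  have h0 := im_apply_star_mul_self hφ a
  have h1 := im_apply_star_mul_self hφ (a + 1)
  have h2 := im_apply_star_mul_self hφ (a + Complex.I • 1)
  have e1 : star (a + 1) * (a + 1) = star a * a + star a + a + 1 := by
    simp only [star_add, star_one]; noncomm_ring
  have e2 : star (a + Complex.I • (1 : A)) * (a + Complex.I • 1)
      = star a * a + Complex.I • star a - Complex.I • a + 1 := by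
    simp only [star_add, star_smul, star_one, add_mul, mul_add, smul_mul_assoc, mul_smul_comm,
      one_mul, mul_one, smul_add, smul_smul, RCLike.star_def, Complex.conj_I, neg_mul, smul_neg,
      Complex.I_mul_I, neg_neg, one_smul, neg_smul]
    abel
  rw [e1] at h1
  rw [e2] at h2
  simp only [map_add, map_sub, map_smul, hφ.2, Complex.add_im, Complex.sub_im, smul_eq_mul,
    Complex.I_mul_im, Complex.one_im, h0] at h1 h2
  apply Complex.ext
  · simp; linarith
  · simp; linarith

theorem re_apply_star_mul_comm (hφ : φ ∈ stateSpace A) (x y : A) :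
    (φ (star y * x)).re = (φ (star x * y)).re := by
  have := apply_star hφ (star x * y)
  rw [star_mul, star_star] at this
  simp [this]

/-- The Cauchy–Schwarz inequality for `a` and `1`. -/
theorem norm_sq_apply_le (hφ : φ ∈ stateSpace A) (a : A) :
    ‖φ a‖ ^ 2 ≤ (φ (star a * a)).re := by
  have h := re_apply_star_mul_self_nonneg hφ (a - φ a • 1)
  have e : star (a - φ a • (1 : A)) * (a - φ a • 1)
      = star a * a - φ a • star a - star (φ a) • a + (star (φ a) * φ a) • 1 := by
    simp only [star_sub, star_smul, star_one, sub_mul, mul_sub, smul_mul_assoc, mul_smul_comm,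
      one_mul, mul_one, smul_sub, smul_smul]
    rw [mul_comm (φ a) (star (φ a))]
    abel
  rw [e] at h
  simp only [map_add, map_sub, map_smul, hφ.2, apply_star hφ, smul_eq_mul, mul_one,
    Complex.add_re, Complex.sub_re, RCLike.star_def, Complex.mul_re, Complex.conj_re,
    Complex.conj_im] at h
  rw [Complex.sq_norm, Complex.normSq_apply]
  linarith

/-- The Cauchy–Schwarz inequality on the unit ball of `a ↦ φ(a⋆a)^(1/2)`. -/
theorem norm_apply_star_mul_le_one (hφ : φ ∈ stateSpace A) {x y : A}
    (hx : (φ (star x * x)).re ≤ 1) (hy : (φ (star y * y)).re ≤ 1) :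
    ‖φ (star x * y)‖ ≤ 1 := by
  set z := φ (star x * y) with hz
  have h := re_apply_star_mul_self_nonneg hφ (y - z • x)
  have e : star (y - z • x) * (y - z • x)
      = star y * y - z • (star y * x) - star z • (star x * y) + (star z * z) • (star x * x) := by
    simp only [star_sub, star_smul, sub_mul, mul_sub, smul_mul_assoc, mul_smul_comm, smul_sub,
      smul_smul]
    rw [mul_comm z (star z)]
    abel
  have hc : φ (star y * x) = star z := by
    rw [hz, ← apply_star hφ, star_mul, star_star]
  have hX := im_apply_star_mul_self hφ x
  rw [e] at h
  simp only [map_add, map_sub, map_smul, smul_eq_mul, hc, ← hz,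
    Complex.add_re, Complex.sub_re, RCLike.star_def, Complex.mul_re, Complex.conj_re,
    Complex.conj_im, Complex.mul_im, hX] at h
  have hn : ‖z‖ ^ 2 = z.re * z.re + z.im * z.im := by
    rw [Complex.sq_norm, Complex.normSq_apply]
  have : ‖z‖ ^ 2 ≤ 1 := by
    nlinarith [mul_nonneg (sq_nonneg ‖z‖) (sub_nonneg.mpr hx)]
  exact (sq_le_one_iff₀ (norm_nonneg z)).mp this

theorem re_apply_star_mul_self_add (hφ : φ ∈ stateSpace A) (x y : A) :
    (φ (star (x + y) * (x + y))).re
      = (φ (star x * x)).re + 2 * (φ (star x * y)).re + (φ (star y * y)).re := by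
  have := re_apply_star_mul_comm hφ x y
  simp only [star_add, add_mul, mul_add, map_add, Complex.add_re]
  linarith

theorem re_apply_star_mul_self_smul (φ : WeakDual ℂ A) (c : ℂ) (x : A) :
    (φ (star (c • x) * (c • x))).re = ‖c‖ ^ 2 * (φ (star x * x)).re := by
  have : star (c • x) * (c • x) = (star c * c) • (star x * x) := by
    simp only [star_smul, smul_mul_assoc, mul_smul_comm, smul_smul]
    rw [mul_comm]
  rw [this, map_smul, smul_eq_mul, RCLike.star_def, Complex.conj_mul']
  rw [← Complex.ofReal_pow, Complex.re_ofReal_mul]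

end stateSpace

/-! ### Covariance functions and almost invariant elements -/

variable {G : Type*} [Group G] [TopologicalSpace G]

namespace CStarAction

open stateSpace

variable {α : CStarAction G A}

/-- The function `g ↦ ψ(α_g(a⋆) a) - |ψ(a)|²`: the covariance of `α_g(a)` and `a` under an
invariant state `ψ`. -/
noncomputable def covariance (α : CStarAction G A) (ψ : WeakDual ℂ A) (a : A) (g : G) : ℂ :=
  ψ (α.toHom g (star a) * a) - star (ψ a) * ψ a

/-- The covariance is the coefficient `ψ(α_g(b)⋆ b)` of the centred element `b = a - ψ(a)1`. -/
theorem covariance_eq {ψ : WeakDual ℂ A} (hψ : ψ ∈ α.invariantStates) (a : A) (g : G) :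
    α.covariance ψ a g
      = ψ (star (α.toHom g (a - ψ a • 1)) * (a - ψ a • 1)) := by
  have e : star (α.toHom g (a - ψ a • (1 : A))) * (a - ψ a • 1)
      = α.toHom g (star a) * a - ψ a • α.toHom g (star a) - star (ψ a) • a
        + (star (ψ a) * ψ a) • 1 := by
    simp only [map_sub, map_smul, map_one, ← map_star, star_sub, star_smul, star_one, sub_mul,
      mul_sub, smul_mul_assoc, mul_smul_comm, one_mul, mul_one, smul_sub, smul_smul]
    rw [mul_comm (ψ a) (star (ψ a))]
    abel
  rw [e, covariance]
  simp only [map_add, map_sub, map_smul, hψ.1.2, hψ.2, apply_star hψ.1, smul_eq_mul, mul_one]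
  ring

theorem isPositiveDefiniteFun_covariance {ψ : WeakDual ℂ A} (hψ : ψ ∈ α.invariantStates) (a : A) :
    IsPositiveDefiniteFun (α.covariance ψ a) := by
  intro n c g
  set b := a - ψ a • (1 : A) with hb
  have key : ∑ i, ∑ j, star (c i) * c j * α.covariance ψ a ((g i)⁻¹ * g j)
      = ψ (star (∑ j, star (c j) • α.toHom (g j) b) * ∑ i, star (c i) • α.toHom (g i) b) := by
    rw [star_sum, Finset.sum_mul_sum, Finset.sum_comm, map_sum]
    refine Finset.sum_congr rfl fun j _ => ?_
    rw [map_sum]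
    refine Finset.sum_congr rfl fun i _ => ?_
    rw [covariance_eq hψ, ← hb, ← hψ.2 (g i)]
    have hg : α.toHom (g i) (star (α.toHom ((g i)⁻¹ * g j) b) * b)
        = star (α.toHom (g j) b) * α.toHom (g i) b := by
      rw [map_mul, map_star, ← StarAlgEquiv.mul_apply, ← map_mul, mul_inv_cancel_left]
    rw [hg]
    simp only [star_smul, star_star, smul_mul_assoc, mul_smul_comm, map_smul, smul_eq_mul]
    ring
  rw [key]
  exact hψ.1.1 _

theorem continuous_covariance (ψ : WeakDual ℂ A) (a : A) : Continuous (α.covariance ψ a) := by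
  have h : Continuous fun g : G => α.toHom g (star a) * a :=
    (α.continuous_orbit (star a)).mul continuous_const
  exact ((map_continuous ψ).comp h).sub continuous_const

theorem tendsto_covariance {ψ : WeakDual ℂ A} (hψ : ψ ∈ α.mixingStates) (a : A) :
    Tendsto (α.covariance ψ a) (cocompact G) (𝓝 0) := by
  have h := (hψ.2 (star a) a).sub_const (star (ψ a) * ψ a)
  rwa [apply_star hψ.1.1, sub_self] at h

/-- The value at `1` is the variance `ψ(a⋆a) - |ψ(a)|²`, which is real and nonnegative. -/
theorem covariance_one (hψ : ψ ∈ stateSpace A) (a : A) :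
    α.covariance ψ a 1 = ((α.covariance ψ a 1).re : ℂ) ∧ 0 ≤ (α.covariance ψ a 1).re := by
  have h : α.covariance ψ a 1 = (((ψ (star a * a)).re - ‖ψ a‖ ^ 2 : ℝ) : ℂ) := by
    have : ψ (star a * a) = ((ψ (star a * a)).re : ℂ) :=
      Complex.ext rfl (by simp [im_apply_star_mul_self hψ])
    rw [covariance, map_one, StarAlgEquiv.one_apply, RCLike.star_def, Complex.conj_mul', this]
    push_cast
    rfl
  rw [h, Complex.ofReal_re]
  exact ⟨rfl, sub_nonneg.mpr (norm_sq_apply_le hψ a)⟩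

theorem covariance_div_mem {ψ : WeakDual ℂ A} (hψ : ψ ∈ α.mixingStates) (a : A)
    (h : α.covariance ψ a 1 ≠ 0) :
    (fun g => α.covariance ψ a g / α.covariance ψ a 1) ∈ normalizedPosDefC0 G := by
  refine ⟨(continuous_covariance ψ a).div_const _, div_self h, ?_, ?_⟩
  · intro n c g
    obtain ⟨h1, h2⟩ := covariance_one (α := α) hψ.1.1 a
    have hinv : 0 ≤ (α.covariance ψ a 1)⁻¹ := by
      rw [h1, ← Complex.ofReal_inv]
      exact Complex.zero_le_real.mpr (inv_nonneg.mpr h2)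
    have := mul_nonneg (isPositiveDefiniteFun_covariance hψ.1 a n c g) hinv
    simpa only [Finset.sum_mul, mul_assoc, div_eq_mul_inv] using this
  · simpa using (tendsto_covariance hψ a).div_const (α.covariance ψ a 1)

/-- A proper convex decomposition `φ = s φ₁ + t φ₂` yields the functional `ω = φ₁ - φ`, which is
bounded for the seminorm of `φ` because `s φ₁(a⋆a) ≤ φ(a⋆a)`. -/
theorem exists_invariant_functional {φ : WeakDual ℂ A} (hφ : φ ∈ α.invariantStates)
    (hne : φ ∉ α.ergodicStates) :
    ∃ ω : WeakDual ℂ A, ω ≠ 0 ∧ ω 1 = 0 ∧ (∀ (g : G) (a : A), ω (α.toHom g a) = ω a) ∧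
      ∃ C : ℝ, ∀ a, ‖ω a‖ ^ 2 ≤ C * (φ (star a * a)).re := by
  rw [ergodicStates, mem_extremePoints_iff_left] at hne
  push Not at hne
  obtain ⟨φ₁, h₁, φ₂, h₂, ⟨s, t, hs, ht, hst, hseg⟩, hd⟩ := hne hφ
  refine ⟨φ₁ - φ, sub_ne_zero.mpr hd, ?_, fun g a => ?_, 2 * (s⁻¹ + 1), fun a => ?_⟩
  · change φ₁ 1 - φ 1 = 0
    rw [h₁.1.2, hφ.1.2, sub_self]
  · change φ₁ _ - φ _ = φ₁ _ - φ _
    rw [h₁.2, hφ.2]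
  · change ‖φ₁ a - φ a‖ ^ 2 ≤ _
    have e : (φ (star a * a)).re = s * (φ₁ (star a * a)).re + t * (φ₂ (star a * a)).re := by
      rw [← hseg]
      change (s • φ₁ (star a * a) + t • φ₂ (star a * a)).re = _
      simp
    have b₁ := norm_sq_apply_le h₁.1 a
    have b := norm_sq_apply_le hφ.1 a
    have p₂ := mul_nonneg ht.le (re_apply_star_mul_self_nonneg h₂.1 a)
    have b₂ : (φ₁ (star a * a)).re ≤ s⁻¹ * (φ (star a * a)).re := by
      rw [le_inv_mul_iff₀ hs]
      linarith
    have tri : ‖φ₁ a - φ a‖ ^ 2 ≤ (‖φ₁ a‖ + ‖φ a‖) ^ 2 := by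
      gcongr
      exact norm_sub_le _ _
    nlinarith [sq_nonneg (‖φ₁ a‖ - ‖φ a‖)]

/-- A centred unit vector, for the seminorm of `φ`, that almost attains the norm of the invariant
functional `ω` is almost invariant: `ω(α_g(a) + a) = 2 ω(a)` forces `α_g(a) + a` to have
almost maximal length. -/
theorem exists_almost_invariant {φ : WeakDual ℂ A} (hφ : φ ∈ α.invariantStates)
    (hne : φ ∉ α.ergodicStates) {ε : ℝ} (hε : 0 < ε) :
    ∃ a : A, φ a = 0 ∧ φ (star a * a) = 1 ∧
      ∀ g : G, ‖φ (α.toHom g (star a) * a) - 1‖ < ε := by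
  obtain ⟨ω, hω, hω1, hinv, C, hC⟩ := exists_invariant_functional hφ hne
  set S : Set ℝ := {r | ∃ a : A, φ a = 0 ∧ (φ (star a * a)).re = 1 ∧ r = ‖ω a‖ ^ 2} with hS
  have hbdd : BddAbove S := by
    refine ⟨C, ?_⟩
    rintro _ ⟨a, -, h, rfl⟩
    simpa [h] using hC a
  -- `sSup S` is the squared norm of `ω` on the centred elements.
  have hle : ∀ x : A, φ x = 0 → ‖ω x‖ ^ 2 ≤ sSup S * (φ (star x * x)).re := by
    intro x hx
    rcases (re_apply_star_mul_self_nonneg hφ.1 x).eq_or_lt with h0 | h0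
    · have := hC x
      rwa [← h0, mul_zero] at this ⊢
    · have hs : ‖(((√(φ (star x * x)).re)⁻¹ : ℝ) : ℂ)‖ ^ 2 = ((φ (star x * x)).re)⁻¹ := by
        rw [Complex.norm_real, Real.norm_eq_abs, sq_abs, inv_pow, Real.sq_sqrt h0.le]
      have hm : ‖ω ((((√(φ (star x * x)).re)⁻¹ : ℝ) : ℂ) • x)‖ ^ 2 ∈ S := by
        refine ⟨_, ?_, ?_, rfl⟩
        · rw [map_smul, hx, smul_zero]
        · rw [re_apply_star_mul_self_smul, hs, inv_mul_cancel₀ h0.ne']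
      have := le_csSup hbdd hm
      rwa [map_smul, norm_smul, mul_pow, hs, inv_mul_le_iff₀ h0, mul_comm] at this
  obtain ⟨b, hb⟩ : ∃ b, ω b ≠ 0 := by
    by_contra! h
    exact hω (DFunLike.ext _ _ h)
  have hpos : 0 < sSup S := by
    have h0 : φ (b - φ b • 1) = 0 := by
      rw [map_sub, map_smul, hφ.1.2, smul_eq_mul, mul_one, sub_self]
    have h1 := hle _ h0
    have h2 : ω (b - φ b • 1) = ω b := by
      rw [map_sub, map_smul, hω1, smul_zero, sub_zero]
    rw [h2] at h1
    have h3 : 0 < ‖ω b‖ ^ 2 := by positivity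
    exact pos_of_mul_pos_left (h3.trans_le h1) (re_apply_star_mul_self_nonneg hφ.1 _)
  have hSne : S.Nonempty := by
    rw [Set.nonempty_iff_ne_empty]
    intro h
    rw [h, Real.sSup_empty] at hpos
    exact lt_irrefl _ hpos
  have hlt : (1 - ε ^ 2 / 4) * sSup S < sSup S := by nlinarith [mul_pos (pow_pos hε 2) hpos]
  obtain ⟨_, ⟨a, ha0, ha1, rfl⟩, har⟩ := exists_lt_of_lt_csSup hSne hlt
  refine ⟨a, ha0, Complex.ext ha1 (im_apply_star_mul_self hφ.1 a), fun g => ?_⟩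
  set z := φ (α.toHom g (star a) * a) with hz
  have hz' : φ (star (α.toHom g a) * a) = z := by rw [hz, map_star]
  have hg1 : (φ (star (α.toHom g a) * α.toHom g a)).re = 1 := by
    rw [← map_star, ← map_mul, hφ.2, ha1]
  have h1 := hle (α.toHom g a + a) (by rw [map_add, hφ.2, ha0, add_zero])
  rw [re_apply_star_mul_self_add hφ.1, hg1, ha1, hz', map_add, hinv, ← two_mul, norm_mul,
    mul_pow, Complex.norm_two] at h1
  have hre : 1 - ε ^ 2 / 2 < z.re := by
    by_contra! hcon
    nlinarith [mul_le_mul_of_nonneg_left hcon hpos.le]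
  have hn : ‖z‖ ≤ 1 := by
    rw [← hz']
    exact norm_apply_star_mul_le_one hφ.1 hg1.le ha1.le
  have hn2 : z.re * z.re + z.im * z.im ≤ 1 := by
    rw [← Complex.normSq_apply, ← Complex.sq_norm]
    exact pow_le_one₀ (norm_nonneg z) hn
  refine lt_of_pow_lt_pow_left₀ 2 hε.le ?_
  rw [Complex.sq_norm, Complex.normSq_apply]
  simp only [Complex.sub_re, Complex.sub_im, Complex.one_re, Complex.one_im, sub_zero]
  nlinarith

end CStarAction

/-! ### Uniform convergence and the Haagerup property -/

/-- A weak-⋆ convergent sequence converges uniformly on norm compact sets: it is bounded by the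
uniform boundedness principle, hence equicontinuous. -/
theorem WeakDual.tendstoUniformlyOn_of_isCompact {ψ : ℕ → WeakDual ℂ A} {φ : WeakDual ℂ A}
    (h : Tendsto ψ atTop (𝓝 φ)) {K : Set A} (hK : IsCompact K) :
    TendstoUniformlyOn (fun n a => ψ n a) φ atTop K := by
  have hpt : ∀ a, Tendsto (fun n => ψ n a) atTop (𝓝 (φ a)) := fun a =>
    ((WeakDual.eval_continuous a).tendsto φ).comp h
  obtain ⟨C, hC⟩ : ∃ C, ∀ n, ‖WeakDual.toStrongDual (ψ n)‖ ≤ C := by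
    refine banach_steinhaus fun a => ?_
    obtain ⟨C, hC⟩ := (hpt a).norm.bddAbove_range
    exact ⟨C, fun n => hC ⟨n, rfl⟩⟩
  have hL : ∀ n, ∀ x y : A, dist (ψ n x) (ψ n y) ≤ C * dist x y := fun n x y => by
    rw [dist_eq_norm, dist_eq_norm, ← map_sub]
    exact (WeakDual.toStrongDual (ψ n)).le_of_opNorm_le (hC n) _
  rw [← tendstoLocallyUniformlyOn_iff_tendstoUniformlyOn_of_compact hK,
    Metric.tendstoLocallyUniformlyOn_iff]
  intro ε hε x _
  have hφx : ∀ᶠ y in 𝓝 x, dist (φ y) (φ x) < ε / 3 :=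
    Metric.tendsto_nhds.mp ((map_continuous φ).tendsto x) _ (by positivity)
  have hCx : ∀ᶠ y in 𝓝 x, C * dist x y < ε / 3 := by
    have : Continuous fun y => C * dist x y := by fun_prop
    exact this.tendsto' x 0 (by simp) |>.eventually_lt_const (by positivity)
  refine ⟨_, mem_nhdsWithin_of_mem_nhds (hφx.and hCx), ?_⟩
  filter_upwards [Metric.tendsto_nhds.mp (hpt x) (ε / 3) (by positivity)] with n hn y hy
  rw [dist_comm] at hn
  linarith [dist_triangle4 (φ y) (φ x) (ψ n x) (ψ n y), hL n x y, hy.1, hy.2]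

end

theorem theorem1p1 {G : Type*} [Group G] [TopologicalSpace G] [IsTopologicalGroup G]
    [LocallyCompactSpace G] [SecondCountableTopology G]
    {A : Type*} [CStarAlgebra A] (α : CStarAction G A)
    (h : ∃ φ ∈ α.invariantStates \ α.ergodicStates, ∃ ψ : ℕ → WeakDual ℂ A,
      (∀ n, ψ n ∈ α.mixingStates) ∧ Tendsto ψ atTop (𝓝 φ)) :
    HaagerupProperty G := by
  obtain ⟨φ, ⟨hφ, hne⟩, ψ, hψ, hlim⟩ := h
  have key : ∀ K : Set G, IsCompact K → ∀ ε : ℝ, 0 < ε →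
      ∃ f ∈ normalizedPosDefC0 G, ∀ g ∈ K, ‖f g - 1‖ < ε := by
    intro K hK ε hε
    obtain ⟨δ, hδ, hδ2, hδε⟩ : ∃ δ : ℝ, 0 < δ ∧ δ ≤ 1 / 4 ∧ 10 * δ ≤ ε :=
      ⟨min (1 / 4) (ε / 10), by positivity, min_le_left _ _,
        by linarith [min_le_right (1 / 4) (ε / 10)]⟩
    obtain ⟨a, ha0, ha1, ha⟩ := CStarAction.exists_almost_invariant hφ hne hδ
    have hcont : Continuous fun g : G => α.toHom g (star a) * a :=
      (α.continuous_orbit (star a)).mul continuous_const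
    -- The identity is added to `K` because the covariance is normalized by its value there.
    have hu := WeakDual.tendstoUniformlyOn_of_isCompact hlim ((hK.insert 1).image hcont)
    have h0 : Tendsto (fun n => star (ψ n a) * ψ n a) atTop (𝓝 0) := by
      have : Tendsto (fun n => ψ n a) atTop (𝓝 (φ a)) :=
        ((WeakDual.eval_continuous a).tendsto φ).comp hlim
      simpa [ha0] using this.star.mul this
    obtain ⟨n, hn, hn0⟩ := ((Metric.tendstoUniformlyOn_iff.mp hu δ hδ).and
      (Metric.tendsto_nhds.mp h0 δ hδ)).exists
    have hF : ∀ g ∈ insert 1 K, ‖α.covariance (ψ n) a g - φ (α.toHom g (star a) * a)‖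
        < 2 * δ := by
      intro g hg
      have h1 := hn _ (Set.mem_image_of_mem _ hg)
      rw [dist_comm, dist_eq_norm] at h1
      rw [dist_zero_right] at hn0
      rw [CStarAction.covariance, sub_right_comm]
      linarith [norm_sub_le (ψ n (α.toHom g (star a) * a) - φ (α.toHom g (star a) * a))
        (star (ψ n a) * ψ n a)]
    set c := α.covariance (ψ n) a 1 with hc
    have hc1 : ‖c - 1‖ < 2 * δ := by
      simpa [ha1] using hF 1 (Set.mem_insert _ _)
    have hc2 : 1 / 2 < ‖c‖ := by
      have := norm_sub_norm_le (1 : ℂ) c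
      rw [norm_one, norm_sub_rev] at this
      linarith
    have hc0 : c ≠ 0 := norm_pos_iff.mp (by linarith)
    refine ⟨_, CStarAction.covariance_div_mem (hψ n) a hc0, fun g hg => ?_⟩
    rw [← hc, div_sub_one hc0, norm_div, div_lt_iff₀ (by linarith)]
    have h1 := hF g (Set.mem_insert_of_mem _ hg)
    have h2 := ha g
    rw [norm_sub_rev] at hc1
    have h3 : ‖α.covariance (ψ n) a g - c‖ < 5 * δ := by
      have e : α.covariance (ψ n) a g - c = (α.covariance (ψ n) a g -
          φ (α.toHom g (star a) * a)) + (φ (α.toHom g (star a) * a) - 1) + (1 - c) := by ring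
      rw [e]
      linarith [norm_add₃_le (a := α.covariance (ψ n) a g - φ (α.toHom g (star a) * a))
        (b := φ (α.toHom g (star a) * a) - 1) (c := 1 - c)]
    nlinarith
  let E := CompactExhaustion.choice G
  choose f hf hfε using fun n : ℕ => key (E n) (E.isCompact n) (1 / (n + 1)) (by positivity)
  refine ⟨f, hf, fun K hK => ?_⟩
  obtain ⟨N, hN⟩ := E.exists_superset_of_isCompact hK
  rw [Metric.tendstoUniformlyOn_iff]
  intro ε hε
  obtain ⟨M, hM⟩ := exists_nat_one_div_lt hε
  filter_upwards [eventually_ge_atTop (max N M)] with n hn g hg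
  rw [dist_comm, dist_eq_norm]
  refine (hfε n g (E.subset (le_of_max_le_left hn) (hN hg))).trans (lt_of_le_of_lt ?_ hM)
  have : (M : ℝ) ≤ n := by exact_mod_cast le_of_max_le_right hn
  gcongr
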